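/- Let $n\in\mathbb N$, let $A=\mathrm{diag}(a_1,\dots,a_n)$, $C_0=\mathrm{diag}(c_1,\dots,c_n)$, $\bar B=\mathrm{diag}(\bar b_1,\dots,\bar b_n)$, $\bar C=\mathrm{diag}(\bar c_1,\dots,\bar c_n)$ be real diagonal matrices, and let $\sigma_0,\sigma_D\in\mathbb R$ be constants ($\sigma_D$ does not vary with the delay $D$ below). Assume that $\bar b_i\neq 0$ for all $i$, and that $s_i:=\sigma_0^2c_i^2+\sigma_D^2\bar c_i^2>0$ for every $i$ with $a_i^2\ge 1$. For a delay $D\in\{0,1,2,\dots\}$ consider the system $[A,C_0;\bar B,\bar C]_D$, $$x_{t+1}=Ax_t+w_tC_0u_t+(\bar B+v_t\bar C)u_{t-D},\qquad t=0,1,2,\dots,$$ with $x_t,u_t\in\mathbb R^n$ and with real square-integrable noises $w_t,v_t$ on a probability space such that the pairs $(w_t,v_t)$, $t\ge 0$, are independent, $E w_t=E v_t=0$, $E w_t^2=\sigma_0^2$, $E v_t^2=\sigma_D^2$ and $E(w_tv_t)=0$. The system is called (asymptotically mean-square) stabilizable if there are $n\times n$ matrices $K_0,\dots,K_D$ such that,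 for all deterministic initial values $x_0,u_{-1},\dots,u_{-D}\in\mathbb R^n$, the closed loop with $$u_t=K_0x_t+\sum_{\tau=1}^{D}K_\tau u_{t-\tau},\qquad t\ge 0,$$ satisfies $\sum_{t=0}^\infty E(u_t'u_t)<\infty$ and $\lim_{t\to\infty}E(x_t'x_t)=0$. Then there is $D_{\max}\in[0,+\infty]$, depending only on $a_i,c_i,\bar b_i,\bar c_i,\sigma_0,\sigma_D$, such that for all such noises and every delay $D$ the system $[A,C_0;\bar B,\bar C]_D$ is stabilizable if and only if $0\le D<D_{\max}$. Moreover: a) if $a_i^2=1$ for every $i$ with $a_i^2\ge 1$, then $D_{\max}=+\infty$; b) if $a_i^2<\bar b_i^2/s_i+1$ for every $i$ with $a_i^2\ge1$, and $a_j^2>1$ for some $j$, then $$D_{\max}=\min_{i:\,a_i^2>1}\frac{\ln(\bar b_i^2)-\ln(\sigma_0^2c_i^2+\sigma_D^2\bar c_i^2)-\ln(a_i^2-1)}{\ln(a_i^2)};$$ c) if $a_i^2\ge \bar b_i^2/s_i+1$ for some $i$ with $a_i^2\ge1$, then $D_{\max}=0$ (so the system is not stabilizable for any $D\ge0$). -/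

import Mathlib

open MeasureTheory ProbabilityTheory Filter Topology Matrix

/-- Square-integrable, centred scalar noises `w` and `v` with variances `σ₀ ^ 2` and `σD ^ 2`,
independent from one time to another, and uncorrelated with each other at equal times. -/
structure IsNoisePair {Ω : Type*} [MeasurableSpace Ω] (μ : Measure Ω)
    (w v : ℕ → Ω → ℝ) (σ₀ σD : ℝ) : Prop where
  measurable_w : ∀ t, Measurable (w t)
  measurable_v : ∀ t, Measurable (v t)
  memLp_w : ∀ t, MemLp (w t) 2 μ
  memLp_v : ∀ t, MemLp (v t) 2 μ
  mean_w : ∀ t, ∫ ω, w t ω ∂μ = 0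
  mean_v : ∀ t, ∫ ω, v t ω ∂μ = 0
  var_w : ∀ t, ∫ ω, w t ω ^ 2 ∂μ = σ₀ ^ 2
  var_v : ∀ t, ∫ ω, v t ω ^ 2 ∂μ = σD ^ 2
  uncorrelated : ∀ t, ∫ ω, w t ω * v t ω ∂μ = 0
  indep : iIndepFun (fun t ω => (w t ω, v t ω)) μ

/-- `(x, u)` is a trajectory of the single-delay system
`x (t + 1) = A x(t) + w(t) C₀ u(t) + (B + v(t) C) u(t - D)`, with initial data
`x 0 = x₀`, `u (-τ) = φ τ` for `1 ≤ τ ≤ D`, in closed loop with the feedback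
`u t = K 0 x(t) + ∑ τ ∈ [1, D], K τ u(t - τ)`.
Such a trajectory exists, and is unique for times `t ≥ 0` of `x` and `t ≥ -D` of `u`; the values
of `u` before time `-D` play no role. Both `x t` and `u t` are functions of the noises at times
`< t`, so that the control is automatically nonanticipative. -/
structure IsClosedLoop {Ω : Type*} {n : ℕ} (w v : ℕ → Ω → ℝ)
    (A C₀ B C : Matrix (Fin n) (Fin n) ℝ) (D : ℕ) (K : ℕ → Matrix (Fin n) (Fin n) ℝ)
    (x₀ : Fin n → ℝ) (φ : ℕ → Fin n → ℝ)
    (x : ℕ → Ω → Fin n → ℝ) (u : ℤ → Ω → Fin n → ℝ) : Prop where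
  init_x : ∀ ω, x 0 ω = x₀
  init_u : ∀ τ ∈ Finset.Icc 1 D, ∀ ω, u (-(τ : ℤ)) ω = φ τ
  feedback : ∀ (t : ℕ) ω,
    u t ω = K 0 *ᵥ x t ω + ∑ τ ∈ Finset.Icc 1 D, K τ *ᵥ u ((t : ℤ) - τ) ω
  dynamics : ∀ (t : ℕ) ω,
    x (t + 1) ω = A *ᵥ x t ω + (w t ω • C₀) *ᵥ u t ω + (B + v t ω • C) *ᵥ u ((t : ℤ) - D) ω

/-- Asymptotic mean-square stabilizability of the system `[A, C₀; B, C]_D` driven by `w`, `v`: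
there are feedback gains, not depending on the initial data, such that from all initial data the
control is square-summable in mean and the state tends to zero in mean square. -/
def Stabilizable {Ω : Type*} [MeasurableSpace Ω] (μ : Measure Ω) {n : ℕ} (w v : ℕ → Ω → ℝ)
    (A C₀ B C : Matrix (Fin n) (Fin n) ℝ) (D : ℕ) : Prop :=
  ∃ K : ℕ → Matrix (Fin n) (Fin n) ℝ, ∀ (x₀ : Fin n → ℝ) (φ : ℕ → Fin n → ℝ),
    ∃ (x : ℕ → Ω → Fin n → ℝ) (u : ℤ → Ω → Fin n → ℝ),
      IsClosedLoop w v A C₀ B C D K x₀ φ x u ∧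
      (∀ t : ℕ, Integrable (fun ω => u t ω ⬝ᵥ u t ω) μ) ∧
      Summable (fun t : ℕ => ∫ ω, u t ω ⬝ᵥ u t ω ∂μ) ∧
      (∀ t : ℕ, Integrable (fun ω => x t ω ⬝ᵥ x t ω) μ) ∧
      Tendsto (fun t : ℕ => ∫ ω, x t ω ⬝ᵥ x t ω ∂μ) atTop (𝓝 0)

/-! ### Independence of the present noise from the past, and second moments. -/

section PastNoise

variable {Ω : Type*} {w v : ℕ → Ω → ℝ}

/-! The coordinates decouple in the dynamics, though not in the feedback. For one coordinate let `y`
be the predictor `a^D x(t) + b ∑ a^(τ-1) u(t-τ)`. It obeys the undelayed recursion `y' = a y + b u +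
noise` (`IsClosedLoop.predictor_succ`), where `w` multiplies `u(t)` and `v` multiplies `u(t-D)`.
Adding to `E y²` the variance that controls in the delay line have yet to contribute gives an energy
`V` with `V' - V = E[(a y + b u)² + l u² - y²]`, `l = a^(2D) s`
(`IsClosedLoop.predictorEnergy_succ`).

Minimising over `u` leaves `(ρ - 1) E y²` with `ρ = a² l / (b² + l)`. If `ρ ≥ 1`, no control lowers
`V`, so a positive `V` cannot tend to zero (`Stabilizable.lt_of_one_le`). If `ρ < 1`, the minimiser
`u = -k y` makes `E y²` summable by telescoping (`IsClosedLoop.stable_of_one_le`). Hence each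
coordinate with `a² ≥ 1` requires exactly `a^(2D) s (a² - 1) < b²`; logarithms turn this into a
bound on `D`. -/

/-- The σ-algebra generated by the noises at times `< t`. -/
@[reducible] def pastNoise (w v : ℕ → Ω → ℝ) (t : ℕ) : MeasurableSpace Ω :=
  ⨆ s ∈ Set.Iio t, MeasurableSpace.comap (fun ω => (w s ω, v s ω)) inferInstance

lemma pastNoise_mono {s t : ℕ} (h : s ≤ t) : pastNoise w v s ≤ pastNoise w v t :=
  biSup_mono fun _ hi => lt_of_lt_of_le hi h

lemma measurable_noise_pastNoise (t : ℕ) :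
    Measurable[pastNoise w v (t + 1)] (fun ω => (w t ω, v t ω)) := by
  have h : MeasurableSpace.comap (fun ω => (w t ω, v t ω)) inferInstance
      ≤ pastNoise w v (t + 1) :=
    le_biSup (fun s => MeasurableSpace.comap (fun ω => (w s ω, v s ω)) inferInstance)
      (show t ∈ Set.Iio (t + 1) from Nat.lt_succ_self t)
  exact (comap_measurable _).mono h le_rfl

variable [mΩ : MeasurableSpace Ω] {μ : Measure Ω} {σ₀ σD : ℝ}

lemma IsNoisePair.measurable_pair (hN : IsNoisePair μ w v σ₀ σD) (t : ℕ) :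
    Measurable (fun ω => (w t ω, v t ω)) :=
  (hN.measurable_w t).prodMk (hN.measurable_v t)

lemma IsNoisePair.pastNoise_le (hN : IsNoisePair μ w v σ₀ σD) (t : ℕ) :
    pastNoise w v t ≤ mΩ :=
  iSup₂_le fun s _ => (hN.measurable_pair s).comap_le

lemma IsNoisePair.indep_pastNoise (hN : IsNoisePair μ w v σ₀ σD) (t : ℕ) :
    Indep (MeasurableSpace.comap (fun ω => (w t ω, v t ω)) inferInstance)
      (pastNoise w v t) μ := by
  have h := indep_iSup_of_disjoint (μ := μ)
    (m := fun s => MeasurableSpace.comap (fun ω => (w s ω, v s ω)) inferInstance)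
    (fun s => (hN.measurable_pair s).comap_le) hN.indep
    (S := {t}) (T := Set.Iio t) (by simp)
  simpa [pastNoise] using h

/-- A square-integrable random variable that depends on the noises at times `< t` only. -/
def SqAdapted (μ : Measure Ω) (w v : ℕ → Ω → ℝ) (t : ℕ) (f : Ω → ℝ) : Prop :=
  Measurable[pastNoise w v t] f ∧ MemLp f 2 μ

namespace SqAdapted

variable {t : ℕ} {f g h : Ω → ℝ}

lemma mono {s t : ℕ} (hst : s ≤ t) (hf : SqAdapted μ w v s f) : SqAdapted μ w v t f :=
  ⟨hf.1.mono (pastNoise_mono hst) le_rfl, hf.2⟩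

lemma const [IsFiniteMeasure μ] (r : ℝ) : SqAdapted μ w v t (fun _ => r) :=
  ⟨measurable_const, memLp_const r⟩

lemma add (hf : SqAdapted μ w v t f) (hg : SqAdapted μ w v t g) :
    SqAdapted μ w v t (fun ω => f ω + g ω) :=
  ⟨hf.1.add hg.1, hf.2.add hg.2⟩

lemma const_mul (r : ℝ) (hf : SqAdapted μ w v t f) : SqAdapted μ w v t (fun ω => r * f ω) :=
  ⟨hf.1.const_mul r, hf.2.const_mul r⟩

lemma sum {ι : Type*} {s : Finset ι} {F : ι → Ω → ℝ}
    (hF : ∀ i ∈ s, SqAdapted μ w v t (F i)) : SqAdapted μ w v t (fun ω => ∑ i ∈ s, F i ω) :=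
  ⟨Finset.measurable_sum s fun i hi => (hF i hi).1, memLp_finsetSum s fun i hi => (hF i hi).2⟩

lemma integrable_sq (hf : SqAdapted μ w v t f) : Integrable (fun ω => f ω ^ 2) μ :=
  hf.2.integrable_sq

lemma integrable_mul (hf : SqAdapted μ w v t f) (hg : SqAdapted μ w v t g) :
    Integrable (fun ω => f ω * g ω) μ :=
  hf.2.integrable_mul hg.2

end SqAdapted

/-- A joint function `p` of the pair is needed because `w t` and `v t` are only uncorrelated, not
independent. -/
lemma IsNoisePair.integral_mul_past (hN : IsNoisePair μ w v σ₀ σD) {t : ℕ} {p : ℝ × ℝ → ℝ}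
    (hp : Measurable p) (hpi : Integrable (fun ω => p (w t ω, v t ω)) μ) {F : Ω → ℝ}
    (hF : Measurable[pastNoise w v t] F) (hFi : Integrable F μ) :
    Integrable (fun ω => p (w t ω, v t ω) * F ω) μ ∧
      ∫ ω, p (w t ω, v t ω) * F ω ∂μ = (∫ ω, p (w t ω, v t ω) ∂μ) * ∫ ω, F ω ∂μ := by
  have hind : IndepFun (fun ω => p (w t ω, v t ω)) F μ := by
    rw [IndepFun_iff_Indep]
    refine indep_of_indep_of_le_left (indep_of_indep_of_le_right (hN.indep_pastNoise t)
      hF.comap_le) ?_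
    exact (hp.comp (comap_measurable (fun ω => (w t ω, v t ω)))).comap_le
  exact ⟨hind.integrable_mul hpi hFi, hind.integral_mul_eq_mul_integral hpi.1 hFi.1⟩

/-- Independence is essential: in general a product of two `L²` functions is only `L¹`. -/
lemma IsNoisePair.memLp_mul_past (hN : IsNoisePair μ w v σ₀ σD) {t : ℕ} {f : Ω → ℝ}
    (hf : SqAdapted μ w v t f) :
    MemLp (fun ω => w t ω * f ω) 2 μ ∧ MemLp (fun ω => v t ω * f ω) 2 μ := by
  have hfm : Measurable f := hf.1.mono (hN.pastNoise_le t) le_rfl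
  constructor
  · refine (memLp_two_iff_integrable_sq ((hN.measurable_w t).mul hfm).aestronglyMeasurable).2 ?_
    simpa only [mul_pow, Pi.mul_apply] using (hN.integral_mul_past (t := t) (p := fun z => z.1 ^ 2)
      (by fun_prop) (hN.memLp_w t).integrable_sq (hf.1.pow_const 2) hf.integrable_sq).1
  · refine (memLp_two_iff_integrable_sq ((hN.measurable_v t).mul hfm).aestronglyMeasurable).2 ?_
    simpa only [mul_pow, Pi.mul_apply] using (hN.integral_mul_past (t := t) (p := fun z => z.2 ^ 2)
      (by fun_prop) (hN.memLp_v t).integrable_sq (hf.1.pow_const 2) hf.integrable_sq).1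

lemma IsNoisePair.sqAdapted_step (hN : IsNoisePair μ w v σ₀ σD) {t : ℕ} {f g h : Ω → ℝ}
    (hf : SqAdapted μ w v t f) (hg : SqAdapted μ w v t g) (hh : SqAdapted μ w v t h) :
    SqAdapted μ w v (t + 1) (fun ω => f ω + w t ω * g ω + v t ω * h ω) := by
  have hm := measurable_noise_pastNoise (w := w) (v := v) t
  have hw : Measurable[pastNoise w v (t + 1)] (w t) := measurable_fst.comp hm
  have hv : Measurable[pastNoise w v (t + 1)] (v t) := measurable_snd.comp hm
  have hle := Nat.le_succ t
  exact ⟨((hf.mono hle).1.add (hw.mul (hg.mono hle).1)).add (hv.mul (hh.mono hle).1),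
    (hf.2.add (hN.memLp_mul_past hg).1).add (hN.memLp_mul_past hh).2⟩

/-- Second moment of an affine function of the current noise with coefficients from the past. -/
lemma IsNoisePair.integral_step_sq (hN : IsNoisePair μ w v σ₀ σD) {t : ℕ} {f g h : Ω → ℝ}
    (hf : SqAdapted μ w v t f) (hg : SqAdapted μ w v t g) (hh : SqAdapted μ w v t h) :
    ∫ ω, (f ω + w t ω * g ω + v t ω * h ω) ^ 2 ∂μ =
      (∫ ω, f ω ^ 2 ∂μ) + σ₀ ^ 2 * (∫ ω, g ω ^ 2 ∂μ) + σD ^ 2 * ∫ ω, h ω ^ 2 ∂μ := by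
  have := hN.indep.isProbabilityMeasure
  have e1 := hN.integral_mul_past (t := t) (p := fun z => z.1 ^ 2) (by fun_prop)
    (hN.memLp_w t).integrable_sq (hg.1.pow_const 2) hg.integrable_sq
  have e2 := hN.integral_mul_past (t := t) (p := fun z => z.2 ^ 2) (by fun_prop)
    (hN.memLp_v t).integrable_sq (hh.1.pow_const 2) hh.integrable_sq
  have e3 := hN.integral_mul_past (t := t) (p := fun z => z.1) (by fun_prop)
    ((hN.memLp_w t).integrable (by norm_num)) (hf.1.mul hg.1) (hf.integrable_mul hg)
  have e4 := hN.integral_mul_past (t := t) (p := fun z => z.2) (by fun_prop)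
    ((hN.memLp_v t).integrable (by norm_num)) (hf.1.mul hh.1) (hf.integrable_mul hh)
  have e5 := hN.integral_mul_past (t := t) (p := fun z => z.1 * z.2) (by fun_prop)
    ((hN.memLp_w t).integrable_mul (hN.memLp_v t)) (hg.1.mul hh.1) (hg.integrable_mul hh)
  simp only [hN.mean_w, hN.mean_v, hN.var_w, hN.var_v, hN.uncorrelated, zero_mul,
    Pi.mul_apply] at e1 e2 e3 e4 e5
  have hexp : ∀ ω, (f ω + w t ω * g ω + v t ω * h ω) ^ 2 =
      f ω ^ 2 + w t ω ^ 2 * g ω ^ 2 + v t ω ^ 2 * h ω ^ 2 + 2 * (w t ω * (f ω * g ω))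
        + 2 * (v t ω * (f ω * h ω)) + 2 * (w t ω * v t ω * (g ω * h ω)) := fun ω => by ring
  simp_rw [hexp]
  have i0 := hf.integrable_sq
  have i1 : Integrable (fun ω => f ω ^ 2 + w t ω ^ 2 * g ω ^ 2) μ := i0.add e1.1
  have i2 : Integrable (fun ω => f ω ^ 2 + w t ω ^ 2 * g ω ^ 2 + v t ω ^ 2 * h ω ^ 2) μ :=
    i1.add e2.1
  have i3 : Integrable (fun ω => f ω ^ 2 + w t ω ^ 2 * g ω ^ 2 + v t ω ^ 2 * h ω ^ 2
      + 2 * (w t ω * (f ω * g ω))) μ := i2.add (e3.1.const_mul 2)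
  have i4 : Integrable (fun ω => f ω ^ 2 + w t ω ^ 2 * g ω ^ 2 + v t ω ^ 2 * h ω ^ 2
      + 2 * (w t ω * (f ω * g ω)) + 2 * (v t ω * (f ω * h ω))) μ := i3.add (e4.1.const_mul 2)
  rw [integral_add i4 (e5.1.const_mul 2), integral_add i3 (e4.1.const_mul 2), integral_add i2 (e3.1.const_mul 2),
    integral_add i1 e2.1, integral_add i0 e1.1]
  simp only [integral_const_mul, e1.2, e2.2, e3.2, e4.2, e5.2]
  ring

end PastNoise

/-! ### Construction of the closed-loop trajectory. -/

section Existence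

variable {Ω : Type*} {n : ℕ}

/-- The state `x t` together with the control history `j ↦ u (t - j)` along one noise path. -/
def loopState (w v : ℕ → ℝ) (A C₀ B C : Matrix (Fin n) (Fin n) ℝ) (D : ℕ)
    (K : ℕ → Matrix (Fin n) (Fin n) ℝ) (x₀ : Fin n → ℝ) (φ : ℕ → Fin n → ℝ) :
    ℕ → (Fin n → ℝ) × (ℕ → Fin n → ℝ)
  | 0 => (x₀, fun j => if j = 0 then K 0 *ᵥ x₀ + ∑ τ ∈ Finset.Icc 1 D, K τ *ᵥ φ τ else φ j)
  | t + 1 =>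
    let s := loopState w v A C₀ B C D K x₀ φ t
    let x' := A *ᵥ s.1 + (w t • C₀) *ᵥ s.2 0 + (B + v t • C) *ᵥ s.2 D
    (x', fun j => if j = 0 then K 0 *ᵥ x' + ∑ τ ∈ Finset.Icc 1 D, K τ *ᵥ s.2 (τ - 1)
      else s.2 (j - 1))

lemma exists_isClosedLoop (w v : ℕ → Ω → ℝ) (A C₀ B C : Matrix (Fin n) (Fin n) ℝ) (D : ℕ)
    (K : ℕ → Matrix (Fin n) (Fin n) ℝ) (x₀ : Fin n → ℝ) (φ : ℕ → Fin n → ℝ) :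
    ∃ x u, IsClosedLoop w v A C₀ B C D K x₀ φ x u := by
  let S : ℕ → Ω → (Fin n → ℝ) × (ℕ → Fin n → ℝ) := fun t ω =>
    loopState (fun s => w s ω) (fun s => v s ω) A C₀ B C D K x₀ φ t
  let u : ℤ → Ω → Fin n → ℝ := fun s ω =>
    if 0 ≤ s then (S s.toNat ω).2 0 else φ (-s).toNat
  -- The stored history agrees with `u` on all of `ℤ`; the initial and closed-loop equations then
  -- reduce to unfolding one step of `loopState`.
  have hist : ∀ (t j : ℕ) ω, (S t ω).2 j = u ((t : ℤ) - j) ω := by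
    intro t
    induction t with
    | zero =>
      intro j ω
      rcases j with _ | j
      · simp [u]
      · have : ¬ (0 : ℤ) ≤ ((0 : ℕ) : ℤ) - ((j + 1 : ℕ) : ℤ) := by omega
        have h2 : (-(((0 : ℕ) : ℤ) - ((j + 1 : ℕ) : ℤ))).toNat = j + 1 := by omega
        simp only [u, if_neg this, h2]
        simp [S, loopState]
    | succ t ih =>
      intro j ω
      rcases j with _ | j
      · have : (0 : ℤ) ≤ ((t + 1 : ℕ) : ℤ) - ((0 : ℕ) : ℤ) := by omega
        have h2 : (((t + 1 : ℕ) : ℤ) - ((0 : ℕ) : ℤ)).toNat = t + 1 := by omega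
        simp only [u, if_pos this, h2]
      · have h1 : (S (t + 1) ω).2 (j + 1) = (S t ω).2 j := by simp [S, loopState]
        rw [h1, ih]
        congr 1
        push_cast
        ring
  refine ⟨fun t ω => (S t ω).1, u, ⟨fun _ => rfl, ?_, ?_, ?_⟩⟩
  · intro τ hτ ω
    rw [Finset.mem_Icc] at hτ
    have : ¬ (0 : ℤ) ≤ -(τ : ℤ) := by omega
    simp [u, if_neg this]
  · intro t ω
    have h0 := hist t 0 ω
    rw [Nat.cast_zero, sub_zero] at h0
    rw [← h0]
    rcases t with _ | t
    · have : ∀ τ ∈ Finset.Icc 1 D, K τ *ᵥ u (((0 : ℕ) : ℤ) - τ) ω = K τ *ᵥ φ τ := by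
        intro τ hτ
        rw [Finset.mem_Icc] at hτ
        have h1 : ¬ (0 : ℤ) ≤ ((0 : ℕ) : ℤ) - τ := by omega
        have h2 : (-(((0 : ℕ) : ℤ) - (τ : ℤ))).toNat = τ := by omega
        simp only [u, if_neg h1, h2]
      rw [Finset.sum_congr rfl this]
      simp [S, loopState]
    · have : ∀ τ ∈ Finset.Icc 1 D,
          K τ *ᵥ u (((t + 1 : ℕ) : ℤ) - τ) ω = K τ *ᵥ (S t ω).2 (τ - 1) := by
        intro τ hτ
        rw [Finset.mem_Icc] at hτ
        rw [hist, show ((t + 1 : ℕ) : ℤ) - τ = t - ((τ - 1 : ℕ) : ℤ) by omega]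
      rw [Finset.sum_congr rfl this]
      simp [S, loopState]
  · intro t ω
    have h0 := hist t 0 ω
    rw [Nat.cast_zero, sub_zero] at h0
    rw [← h0, ← hist t D ω]
    simp [S, loopState]

end Existence

/-! ### Adaptedness, the predictor and its energy balance. -/

section Trajectory

variable {Ω : Type*} [MeasurableSpace Ω] {μ : Measure Ω}
  {w v : ℕ → Ω → ℝ} {σ₀ σD : ℝ} {n D : ℕ} {K : ℕ → Matrix (Fin n) (Fin n) ℝ}
  {x₀ : Fin n → ℝ} {φ : ℕ → Fin n → ℝ} {x : ℕ → Ω → Fin n → ℝ} {u : ℤ → Ω → Fin n → ℝ}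

lemma SqAdapted.mulVec {t m : ℕ} (M : Matrix (Fin m) (Fin n) ℝ) {f : Ω → Fin n → ℝ}
    (hf : ∀ i, SqAdapted μ w v t (fun ω => f ω i)) (i : Fin m) :
    SqAdapted μ w v t (fun ω => (M *ᵥ f ω) i) := by
  simp only [Matrix.mulVec, dotProduct]
  exact SqAdapted.sum fun j _ => (hf j).const_mul _

section Adapted

variable {A C₀ B C : Matrix (Fin n) (Fin n) ℝ}

lemma IsClosedLoop.sqAdapted_feedback (hL : IsClosedLoop w v A C₀ B C D K x₀ φ x u) {t : ℕ}
    (hx : ∀ i, SqAdapted μ w v t (fun ω => x t ω i))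
    (hu : ∀ s : ℤ, -(D : ℤ) ≤ s → s < t → ∀ i, SqAdapted μ w v t (fun ω => u s ω i)) (i : Fin n) :
    SqAdapted μ w v t (fun ω => u t ω i) := by
  simp only [hL.feedback, Pi.add_apply, Finset.sum_apply]
  refine (SqAdapted.mulVec _ hx i).add (SqAdapted.sum fun τ hτ => ?_)
  rw [Finset.mem_Icc] at hτ
  exact SqAdapted.mulVec _ (hu _ (by omega) (by omega)) i

/-- The lower limit `-D` is forced: earlier values of `u` are arbitrary functions, possibly not even
measurable. -/
lemma IsClosedLoop.sqAdapted (hL : IsClosedLoop w v A C₀ B C D K x₀ φ x u)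
    (hN : IsNoisePair μ w v σ₀ σD) (t : ℕ) :
    (∀ i, SqAdapted μ w v t (fun ω => x t ω i)) ∧
      ∀ s : ℤ, -(D : ℤ) ≤ s → s ≤ t → ∀ i, SqAdapted μ w v t (fun ω => u s ω i) := by
  have := hN.indep.isProbabilityMeasure
  induction t with
  | zero =>
    have hx : ∀ i, SqAdapted μ w v 0 (fun ω => x 0 ω i) := fun i => by
      simp only [hL.init_x]
      exact SqAdapted.const _
    have hu : ∀ s : ℤ, -(D : ℤ) ≤ s → s < (0 : ℕ) →
        ∀ i, SqAdapted μ w v 0 (fun ω => u s ω i) := fun s h1 h2 i => by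
      obtain ⟨τ, rfl⟩ : ∃ τ : ℕ, s = -(τ : ℤ) := ⟨(-s).toNat, by omega⟩
      simp only [hL.init_u τ (Finset.mem_Icc.2 ⟨by omega, by omega⟩)]
      exact SqAdapted.const _
    refine ⟨hx, fun s h1 h2 i => ?_⟩
    rcases h2.lt_or_eq with h | rfl
    · exact hu s h1 h i
    · exact hL.sqAdapted_feedback hx hu i
  | succ t ih =>
    have hx : ∀ i, SqAdapted μ w v (t + 1) (fun ω => x (t + 1) ω i) := fun i => by
      have h := hN.sqAdapted_step
        ((SqAdapted.mulVec A ih.1 i).add (SqAdapted.mulVec B (ih.2 (t - D) (by omega) (by omega)) i))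
        (SqAdapted.mulVec C₀ (ih.2 t (by omega) le_rfl) i)
        (SqAdapted.mulVec C (ih.2 (t - D) (by omega) (by omega)) i)
      convert h using 2 with ω
      rw [hL.dynamics]
      simp only [Pi.add_apply, Matrix.add_mulVec, Matrix.smul_mulVec, Pi.smul_apply, smul_eq_mul]
      ring
    have hu : ∀ s : ℤ, -(D : ℤ) ≤ s → s < (t + 1 : ℕ) →
        ∀ i, SqAdapted μ w v (t + 1) (fun ω => u s ω i) := fun s h1 h2 i =>
      (ih.2 s h1 (by omega) i).mono (Nat.le_succ t)
    refine ⟨hx, fun s h1 h2 i => ?_⟩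
    rcases h2.lt_or_eq with h | rfl
    · exact hu s h1 h i
    · exact hL.sqAdapted_feedback hx hu i

end Adapted

/-- Shifting the window of a discounted moving sum by one step. -/
lemma sum_window_succ (a : ℝ) (f : ℤ → ℝ) (D t : ℕ) :
    (∑ τ ∈ Finset.Icc 1 D, a ^ (τ - 1) * f (((t + 1 : ℕ) : ℤ) - τ)) + a ^ D * f ((t : ℤ) - D) =
      f t + a * ∑ τ ∈ Finset.Icc 1 D, a ^ (τ - 1) * f ((t : ℤ) - τ) := by
  have key : ∀ g : ℕ → ℝ, ∑ τ ∈ Finset.Icc 1 D, g τ = ∑ j ∈ Finset.range D, g (j + 1) := by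
    intro g
    rw [Finset.range_eq_Ico, Finset.sum_Ico_add' g 0 D 1]
    rfl
  rw [key, key, Finset.mul_sum]
  have h1 := Finset.sum_range_succ (fun j : ℕ => a ^ j * f ((t : ℤ) - j)) D
  rw [Finset.sum_range_succ'] at h1
  have h2 : ∀ j ∈ Finset.range D, a ^ (j + 1 - 1) * f (((t + 1 : ℕ) : ℤ) - ((j + 1 : ℕ) : ℤ)) =
      a ^ j * f ((t : ℤ) - j) := fun j _ => by
    rw [Nat.add_sub_cancel]
    congr 2
    push_cast
    ring
  have h3 : ∀ j ∈ Finset.range D, a * (a ^ (j + 1 - 1) * f ((t : ℤ) - ((j + 1 : ℕ) : ℤ))) =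
      a ^ (j + 1) * f ((t : ℤ) - ((j + 1 : ℕ) : ℤ)) := fun j _ => by
    rw [Nat.add_sub_cancel]
    ring
  rw [Finset.sum_congr rfl h2, Finset.sum_congr rfl h3, ← h1]
  simp [add_comm]

variable {a c b cbar : Fin n → ℝ}

/-- The `D`-step prediction of the coordinate `i` of the state from the noises before time `t`. -/
def predictor (a b : Fin n → ℝ) (D : ℕ) (x : ℕ → Ω → Fin n → ℝ) (u : ℤ → Ω → Fin n → ℝ)
    (i : Fin n) (t : ℕ) (ω : Ω) : ℝ :=
  a i ^ D * x t ω i + b i * ∑ τ ∈ Finset.Icc 1 D, a i ^ (τ - 1) * u ((t : ℤ) - τ) ω i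

/-- Second moment of the predictor plus the energy stored in the delay line. -/
noncomputable def predictorEnergy (μ : Measure Ω) (a b cbar : Fin n → ℝ) (σD : ℝ) (D : ℕ)
    (x : ℕ → Ω → Fin n → ℝ) (u : ℤ → Ω → Fin n → ℝ) (i : Fin n) (t : ℕ) : ℝ :=
  (∫ ω, predictor a b D x u i t ω ^ 2 ∂μ) +
    (a i ^ D) ^ 2 * (σD ^ 2 * cbar i ^ 2) *
      ∑ τ ∈ Finset.Icc 1 D, ∫ ω, u ((t : ℤ) - τ) ω i ^ 2 ∂μ

lemma predictorEnergy_nonneg (i : Fin n) (t : ℕ) :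
    0 ≤ predictorEnergy μ a b cbar σD D x u i t :=
  add_nonneg (integral_nonneg fun _ => sq_nonneg _)
    (mul_nonneg (by positivity) (Finset.sum_nonneg fun _ _ => integral_nonneg fun _ => sq_nonneg _))

variable (hL : IsClosedLoop w v (Matrix.diagonal a) (Matrix.diagonal c) (Matrix.diagonal b)
  (Matrix.diagonal cbar) D K x₀ φ x u)

include hL

lemma IsClosedLoop.dynamics_apply (t : ℕ) (ω : Ω) (i : Fin n) :
    x (t + 1) ω i = a i * x t ω i + b i * u ((t : ℤ) - D) ω i + w t ω * (c i * u t ω i)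
      + v t ω * (cbar i * u ((t : ℤ) - D) ω i) := by
  rw [hL.dynamics]
  simp only [Pi.add_apply, Matrix.add_mulVec, Matrix.smul_mulVec, Pi.smul_apply, smul_eq_mul,
    Matrix.mulVec_diagonal]
  ring

/-- The delayed term `a^D b u(t-D)` coming from the dynamics is exactly what the moving window
loses, so only `b u(t)` remains in the drift. -/
lemma IsClosedLoop.predictor_succ (t : ℕ) (ω : Ω) (i : Fin n) :
    predictor a b D x u i (t + 1) ω =
      (a i * predictor a b D x u i t ω + b i * u t ω i) + w t ω * (a i ^ D * c i * u t ω i)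
        + v t ω * (a i ^ D * cbar i * u ((t : ℤ) - D) ω i) := by
  have h := sum_window_succ (a i) (fun s => u s ω i) D t
  rw [predictor, predictor, hL.dynamics_apply, ← sub_eq_zero]
  linear_combination b i * h

lemma IsClosedLoop.sqAdapted_predictor (hN : IsNoisePair μ w v σ₀ σD) (t : ℕ) (i : Fin n) :
    SqAdapted μ w v t (predictor a b D x u i t) := by
  obtain ⟨hx, hu⟩ := hL.sqAdapted hN t
  refine ((hx i).const_mul _).add (SqAdapted.const_mul _ (SqAdapted.sum fun τ hτ => ?_))
  rw [Finset.mem_Icc] at hτ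
  exact (hu _ (by omega) (by omega) i).const_mul _

lemma IsClosedLoop.integral_predictor_succ (hN : IsNoisePair μ w v σ₀ σD) (t : ℕ) (i : Fin n) :
    ∫ ω, predictor a b D x u i (t + 1) ω ^ 2 ∂μ =
      (∫ ω, (a i * predictor a b D x u i t ω + b i * u t ω i) ^ 2 ∂μ) +
        (a i ^ D) ^ 2 * (σ₀ ^ 2 * c i ^ 2) * (∫ ω, u t ω i ^ 2 ∂μ) +
        (a i ^ D) ^ 2 * (σD ^ 2 * cbar i ^ 2) * ∫ ω, u ((t : ℤ) - D) ω i ^ 2 ∂μ := by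
  have hu := (hL.sqAdapted hN t).2
  have h := hN.integral_step_sq
    (((hL.sqAdapted_predictor hN t i).const_mul (a i)).add
      ((hu t (by omega) le_rfl i).const_mul (b i)))
    ((hu t (by omega) le_rfl i).const_mul (a i ^ D * c i))
    ((hu (t - D) (by omega) (by omega) i).const_mul (a i ^ D * cbar i))
  simp_rw [hL.predictor_succ]
  rw [h]
  simp only [mul_pow, integral_const_mul]
  ring

/-- When the window moves, the `v`-variance due to `u(t-D)` is traded for the same multiple of `E
u(t)²`, so both noises act through the single coefficient `l`. -/
lemma IsClosedLoop.predictorEnergy_succ (hN : IsNoisePair μ w v σ₀ σD) (t : ℕ) (i : Fin n) :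
    predictorEnergy μ a b cbar σD D x u i (t + 1) =
      (∫ ω, (a i * predictor a b D x u i t ω + b i * u t ω i) ^ 2 ∂μ) +
        (a i ^ D) ^ 2 * (σ₀ ^ 2 * c i ^ 2 + σD ^ 2 * cbar i ^ 2) * (∫ ω, u t ω i ^ 2 ∂μ) +
        (predictorEnergy μ a b cbar σD D x u i t - ∫ ω, predictor a b D x u i t ω ^ 2 ∂μ) := by
  have h := sum_window_succ 1 (fun s => ∫ ω, u s ω i ^ 2 ∂μ) D t
  simp only [one_pow, one_mul] at h
  rw [predictorEnergy, predictorEnergy, hL.integral_predictor_succ hN]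
  linear_combination (a i ^ D) ^ 2 * (σD ^ 2 * cbar i ^ 2) * h

end Trajectory

/-! ### The stabilizability criterion, coordinate by coordinate. -/

section Criterion

variable {Ω : Type*} [MeasurableSpace Ω] {μ : Measure Ω}
  {w v : ℕ → Ω → ℝ} {σ₀ σD : ℝ} {n D : ℕ} {K : ℕ → Matrix (Fin n) (Fin n) ℝ}
  {x₀ : Fin n → ℝ} {φ : ℕ → Fin n → ℝ} {x : ℕ → Ω → Fin n → ℝ} {u : ℤ → Ω → Fin n → ℝ}
  {a c b cbar : Fin n → ℝ}

section Necessity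

variable (hL : IsClosedLoop w v (Matrix.diagonal a) (Matrix.diagonal c) (Matrix.diagonal b)
  (Matrix.diagonal cbar) D K x₀ φ x u)

include hL

lemma IsClosedLoop.predictorEnergy_le_succ (hN : IsNoisePair μ w v σ₀ σD) {i : Fin n}
    (hl : 0 < (a i ^ D) ^ 2 * (σ₀ ^ 2 * c i ^ 2 + σD ^ 2 * cbar i ^ 2))
    (h : b i ^ 2 ≤
      (a i ^ D) ^ 2 * (σ₀ ^ 2 * c i ^ 2 + σD ^ 2 * cbar i ^ 2) * (a i ^ 2 - 1)) (t : ℕ) :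
    predictorEnergy μ a b cbar σD D x u i t ≤ predictorEnergy μ a b cbar σD D x u i (t + 1) := by
  rw [hL.predictorEnergy_succ hN]
  set l := (a i ^ D) ^ 2 * (σ₀ ^ 2 * c i ^ 2 + σD ^ 2 * cbar i ^ 2)
  have hy := hL.sqAdapted_predictor hN t i
  have hu := (hL.sqAdapted hN t).2 t (by omega) le_rfl i
  have hz := (hy.const_mul (a i)).add (hu.const_mul (b i))
  have key : ∫ ω, predictor a b D x u i t ω ^ 2 ∂μ ≤
      ∫ ω, ((a i * predictor a b D x u i t ω + b i * u t ω i) ^ 2 + l * u t ω i ^ 2) ∂μ := by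
    refine integral_mono hy.integrable_sq
      (hz.integrable_sq.add (hu.integrable_sq.const_mul l)) fun ω => ?_
    have hpos : 0 < b i ^ 2 + l := by positivity
    have := mul_nonneg (sub_nonneg.2 h) (sq_nonneg (predictor a b D x u i t ω))
    refine le_of_mul_le_mul_left ?_ hpos
    -- Completing the square: `(b² + l)((a y + b u)² + l u² - y²) = ((b² + l) u + a b y)² + (l (a² -
    -- 1) - b²) y²`.
    nlinarith [sq_nonneg ((b i ^ 2 + l) * u t ω i + a i * b i * predictor a b D x u i t ω)]
  rw [integral_add hz.integrable_sq (hu.integrable_sq.const_mul l), integral_const_mul] at key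
  linarith

end Necessity

lemma integral_sq_le_integral_dotProduct {f : Ω → Fin n → ℝ}
    (hf : Integrable (fun ω => f ω ⬝ᵥ f ω) μ) (i : Fin n) :
    ∫ ω, f ω i ^ 2 ∂μ ≤ ∫ ω, f ω ⬝ᵥ f ω ∂μ := by
  refine integral_mono_of_nonneg (ae_of_all _ fun _ => sq_nonneg _) hf (ae_of_all _ fun ω => ?_)
  simp only [dotProduct, ← sq]
  exact Finset.single_le_sum (f := fun j => f ω j ^ 2) (fun _ _ => sq_nonneg _) (Finset.mem_univ i)

lemma add_sum_sq_le (y : ℝ) {ι : Type*} (s : Finset ι) (f : ι → ℝ) :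
    (y + ∑ j ∈ s, f j) ^ 2 ≤ 2 * y ^ 2 + 2 * s.card * ∑ j ∈ s, f j ^ 2 := by
  nlinarith [sq_sum_le_card_mul_sum_sq (s := s) (f := f), sq_nonneg (y - ∑ j ∈ s, f j)]

/-- A sequence dominated by a finite sum of square-integrable sequences, each tending to zero in
mean square, tends to zero in mean square. -/
lemma tendsto_integral_sq_of_sq_le {z y : ℕ → Ω → ℝ} {ι : Type*} (s : Finset ι)
    {f : ι → ℕ → Ω → ℝ} (hz : ∀ t ω, z t ω ^ 2 ≤ (y t ω + ∑ j ∈ s, f j t ω) ^ 2)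
    (hyi : ∀ t, Integrable (fun ω => y t ω ^ 2) μ)
    (hfi : ∀ j ∈ s, ∀ t, Integrable (fun ω => f j t ω ^ 2) μ)
    (hy : Tendsto (fun t => ∫ ω, y t ω ^ 2 ∂μ) atTop (𝓝 0))
    (hf : ∀ j ∈ s, Tendsto (fun t => ∫ ω, f j t ω ^ 2 ∂μ) atTop (𝓝 0)) :
    Tendsto (fun t => ∫ ω, z t ω ^ 2 ∂μ) atTop (𝓝 0) := by
  have hlim : Tendsto (fun t => 2 * (∫ ω, y t ω ^ 2 ∂μ) +
      2 * s.card * ∑ j ∈ s, ∫ ω, f j t ω ^ 2 ∂μ) atTop (𝓝 0) := by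
    simpa using (hy.const_mul 2).add ((tendsto_finsetSum s hf).const_mul (2 * (s.card : ℝ)))
  refine squeeze_zero (fun t => integral_nonneg fun _ => sq_nonneg _) (fun t => ?_) hlim
  have i1 := (hyi t).const_mul 2
  have i2 := (integrable_finsetSum s fun j hj => hfi j hj t).const_mul (2 * (s.card : ℝ))
  calc ∫ ω, z t ω ^ 2 ∂μ
      ≤ ∫ ω, (2 * y t ω ^ 2 + 2 * s.card * ∑ j ∈ s, f j t ω ^ 2) ∂μ :=
        integral_mono_of_nonneg (ae_of_all _ fun _ => sq_nonneg _) (i1.add i2)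
          (ae_of_all _ fun ω => (hz t ω).trans (add_sum_sq_le _ _ _))
    _ = _ := by
        rw [integral_add i1 i2, integral_const_mul, integral_const_mul,
          integral_finsetSum s fun j hj => hfi j hj t]

lemma tendsto_shift_sub {f : ℤ → ℝ} {l : ℝ} (τ : ℕ)
    (hf : Tendsto (fun t : ℕ => f t) atTop (𝓝 l)) :
    Tendsto (fun t : ℕ => f ((t : ℤ) - τ)) atTop (𝓝 l) := by
  rw [← tendsto_add_atTop_iff_nat τ]
  simpa using hf

/-- Stabilizability forces the delay bound on every coordinate that is not contracting. -/
lemma Stabilizable.lt_of_one_le (hN : IsNoisePair μ w v σ₀ σD)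
    (hS : Stabilizable μ w v (Matrix.diagonal a) (Matrix.diagonal c) (Matrix.diagonal b)
      (Matrix.diagonal cbar) D) {i : Fin n} (ha : 1 ≤ a i ^ 2)
    (hs : 0 < σ₀ ^ 2 * c i ^ 2 + σD ^ 2 * cbar i ^ 2) :
    (a i ^ D) ^ 2 * (σ₀ ^ 2 * c i ^ 2 + σD ^ 2 * cbar i ^ 2) * (a i ^ 2 - 1) < b i ^ 2 := by
  have := hN.indep.isProbabilityMeasure
  by_contra! hcon
  obtain ⟨K, hK⟩ := hS
  -- With an empty delay line and a unit state, the initial energy is `a^(2D) > 0`.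
  obtain ⟨x, u, hL, hui, hus, hxi, hx⟩ := hK (Pi.single i 1) 0
  have ha0 : a i ≠ 0 := by
    rintro h
    norm_num [h] at ha
  have hmono : Monotone (predictorEnergy μ a b cbar σD D x u i) :=
    monotone_nat_of_le_succ (hL.predictorEnergy_le_succ hN (by positivity) hcon)
  have h0 : predictorEnergy μ a b cbar σD D x u i 0 = (a i ^ D) ^ 2 := by
    have hz : ∀ τ ∈ Finset.Icc 1 D, ∀ ω, u (-(τ : ℤ)) ω = 0 := hL.init_u
    have hy : ∀ ω, predictor a b D x u i 0 ω = a i ^ D := fun ω => by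
      rw [predictor, Finset.sum_eq_zero fun τ hτ => by simp [hz τ hτ], hL.init_x]
      simp
    rw [predictorEnergy, Finset.sum_eq_zero fun τ hτ => by simp [hz τ hτ]]
    simp [hy]
  have hu0 : Tendsto (fun t : ℕ => ∫ ω, u t ω i ^ 2 ∂μ) atTop (𝓝 0) :=
    squeeze_zero (fun _ => integral_nonneg fun _ => sq_nonneg _)
      (fun t => integral_sq_le_integral_dotProduct (hui t) i) hus.tendsto_atTop_zero
  have hx0 : Tendsto (fun t : ℕ => ∫ ω, x t ω i ^ 2 ∂μ) atTop (𝓝 0) :=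
    squeeze_zero (fun _ => integral_nonneg fun _ => sq_nonneg _)
      (fun t => integral_sq_le_integral_dotProduct (hxi t) i) hx
  have huτ : ∀ τ : ℕ, Tendsto (fun t : ℕ => ∫ ω, u ((t : ℤ) - τ) ω i ^ 2 ∂μ) atTop (𝓝 0) :=
    fun τ => tendsto_shift_sub (f := fun s => ∫ ω, u s ω i ^ 2 ∂μ) τ hu0
  have hui' : ∀ τ ∈ Finset.Icc 1 D, ∀ t : ℕ, SqAdapted μ w v t (fun ω => u ((t : ℤ) - τ) ω i) :=
    fun τ hτ t => (hL.sqAdapted hN t).2 _ (by have := Finset.mem_Icc.1 hτ; omega) (by omega) i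
  -- The predictor combines the state and the last `D` controls, all of which vanish in mean square.
  have hy0 : Tendsto (fun t => ∫ ω, predictor a b D x u i t ω ^ 2 ∂μ) atTop (𝓝 0) := by
    refine tendsto_integral_sq_of_sq_le (Finset.Icc 1 D)
      (y := fun t ω => a i ^ D * x t ω i)
      (f := fun τ t ω => b i * a i ^ (τ - 1) * u ((t : ℤ) - τ) ω i) (fun t ω => ?_)
      (fun t => (((hL.sqAdapted hN t).1 i).const_mul _).integrable_sq)
      (fun τ hτ t => ((hui' τ hτ t).const_mul _).integrable_sq) ?_ (fun τ _ => ?_)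
    · rw [predictor, Finset.mul_sum]
      simp only [mul_assoc, le_refl]
    · simpa only [mul_pow, integral_const_mul, mul_zero] using hx0.const_mul ((a i ^ D) ^ 2)
    · simpa only [mul_pow, integral_const_mul, mul_zero] using
        (huτ τ).const_mul (b i ^ 2 * (a i ^ (τ - 1)) ^ 2)
  have hE : Tendsto (fun t => predictorEnergy μ a b cbar σD D x u i t) atTop (𝓝 0) := by
    have := hy0.add ((tendsto_finsetSum (Finset.Icc 1 D) fun τ _ => huτ τ).const_mul
      ((a i ^ D) ^ 2 * (σD ^ 2 * cbar i ^ 2)))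
    simpa only [predictorEnergy, Finset.sum_const_zero, mul_zero, add_zero] using this
  have hle := hmono.ge_of_tendsto hE 0
  rw [h0] at hle
  have : 0 < (a i ^ D) ^ 2 := by positivity
  linarith

/-- Feedback gains realizing `u t = - k * predictor t` in every coordinate. -/
def predictorGain (a b k : Fin n → ℝ) (D : ℕ) (τ : ℕ) : Matrix (Fin n) (Fin n) ℝ :=
  Matrix.diagonal fun i => -k i * if τ = 0 then a i ^ D else b i * a i ^ (τ - 1)

section Sufficiency

variable {k : Fin n → ℝ} (hL : IsClosedLoop w v (Matrix.diagonal a) (Matrix.diagonal c)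
  (Matrix.diagonal b) (Matrix.diagonal cbar) D (predictorGain a b k D) x₀ φ x u)

include hL

lemma IsClosedLoop.control_eq_predictor (t : ℕ) (ω : Ω) (i : Fin n) :
    u t ω i = -k i * predictor a b D x u i t ω := by
  rw [hL.feedback, predictor, Pi.add_apply, Finset.sum_apply, mul_add, Finset.mul_sum,
    Finset.mul_sum]
  refine congrArg₂ _ ?_ (Finset.sum_congr rfl fun τ hτ => ?_)
  · simp [predictorGain, Matrix.mulVec_diagonal, mul_assoc]
  · have : τ ≠ 0 := by have := Finset.mem_Icc.1 hτ; omega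
    simp only [predictorGain, Matrix.mulVec_diagonal, if_neg this]
    ring

lemma IsClosedLoop.stable_of_sq_lt_one {i : Fin n} (ha : a i ^ 2 < 1)
    (hk : k i = 0) :
    Summable (fun t : ℕ => ∫ ω, u t ω i ^ 2 ∂μ) ∧
      Tendsto (fun t : ℕ => ∫ ω, x t ω i ^ 2 ∂μ) atTop (𝓝 0) := by
  have hu : ∀ (t : ℕ) ω, u t ω i = 0 := fun t ω => by
    rw [hL.control_eq_predictor, hk]
    ring
  refine ⟨by simp [hu, summable_zero], ?_⟩
  -- Only from time `D` on has the initial control segment left the delay line.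
  have hx : ∀ m ω, x (m + D) ω i = a i ^ m * x D ω i := by
    intro m ω
    induction m with
    | zero => simp
    | succ m ih =>
      rw [show m + 1 + D = m + D + 1 by omega, hL.dynamics_apply, ih,
        show ((m + D : ℕ) : ℤ) - D = (m : ℕ) by push_cast; ring, hu, hu]
      ring
  rw [← tendsto_add_atTop_iff_nat D]
  simp only [hx, mul_pow, integral_const_mul]
  simp only [← pow_mul, mul_comm _ 2]
  simp only [pow_mul]
  simpa using (tendsto_pow_atTop_nhds_zero_of_lt_one (sq_nonneg (a i)) ha).mul_const
    (∫ ω, x D ω i ^ 2 ∂μ)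

lemma IsClosedLoop.stable_of_one_le (hN : IsNoisePair μ w v σ₀ σD) {i : Fin n}
    (ha : 1 ≤ a i ^ 2) (hs : 0 < σ₀ ^ 2 * c i ^ 2 + σD ^ 2 * cbar i ^ 2)
    (hk : k i = a i * b i /
      (b i ^ 2 + (a i ^ D) ^ 2 * (σ₀ ^ 2 * c i ^ 2 + σD ^ 2 * cbar i ^ 2)))
    (h : (a i ^ D) ^ 2 * (σ₀ ^ 2 * c i ^ 2 + σD ^ 2 * cbar i ^ 2) * (a i ^ 2 - 1) < b i ^ 2) :
    Summable (fun t : ℕ => ∫ ω, u t ω i ^ 2 ∂μ) ∧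
      Tendsto (fun t : ℕ => ∫ ω, x t ω i ^ 2 ∂μ) atTop (𝓝 0) := by
  have ha0 : a i ≠ 0 := by
    rintro h
    norm_num [h] at ha
  have hstep := fun t => hL.predictorEnergy_succ (μ := μ) hN t i
  set l := (a i ^ D) ^ 2 * (σ₀ ^ 2 * c i ^ 2 + σD ^ 2 * cbar i ^ 2)
  have hl : 0 < l := by positivity
  have hpos : 0 < b i ^ 2 + l := by positivity
  set ρ := a i ^ 2 * l / (b i ^ 2 + l) with hρdef
  have hρ : ρ < 1 := by
    rw [hρdef, div_lt_one hpos]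
    linarith
  set Y : ℕ → ℝ := fun t => ∫ ω, predictor a b D x u i t ω ^ 2 ∂μ with hY
  have hU : ∀ t : ℕ, ∫ ω, u t ω i ^ 2 ∂μ = k i ^ 2 * Y t := fun t => by
    simp only [hL.control_eq_predictor, mul_pow, integral_const_mul, neg_sq, hY]
  have hdec : ∀ t, (1 - ρ) * Y t =
      predictorEnergy μ a b cbar σD D x u i t - predictorEnergy μ a b cbar σD D x u i (t + 1) := by
    intro t
    have h1 : ∀ ω, (a i * predictor a b D x u i t ω + b i * u t ω i) ^ 2 =
        (a i - b i * k i) ^ 2 * predictor a b D x u i t ω ^ 2 := fun ω => by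
      rw [hL.control_eq_predictor]
      ring
    -- The gain `k` is the minimiser of this quadratic, and `ρ` its minimum.
    have h2 : (a i - b i * k i) ^ 2 + l * k i ^ 2 = ρ := by
      rw [hk, hρdef]
      field_simp
      ring
    rw [hstep, hU]
    simp only [h1, integral_const_mul]
    rw [← h2]
    ring
  have hYn : ∀ t, 0 ≤ Y t := fun t => integral_nonneg fun _ => sq_nonneg _
  have hYs : Summable Y := by
    have : Summable fun t => (1 - ρ) * Y t := by
      refine summable_of_sum_range_le (c := predictorEnergy μ a b cbar σD D x u i 0)
        (fun t => mul_nonneg (by linarith) (hYn t)) fun N => ?_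
      simp only [hdec]
      rw [Finset.sum_range_sub']
      linarith [predictorEnergy_nonneg (μ := μ) (a := a) (b := b) (cbar := cbar) (σD := σD)
        (D := D) (x := x) (u := u) i N]
    exact (summable_mul_left_iff (by linarith)).1 this
  have hUs : Summable (fun t : ℕ => ∫ ω, u t ω i ^ 2 ∂μ) := by
    simp only [hU]
    exact hYs.mul_left _
  refine ⟨hUs, ?_⟩
  refine tendsto_integral_sq_of_sq_le (Finset.Icc 1 D)
    (y := fun t => predictor a b D x u i t)
    (f := fun τ t ω => -b i * a i ^ (τ - 1) * u ((t : ℤ) - τ) ω i) (fun t ω => ?_)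
    (fun t => (hL.sqAdapted_predictor hN t i).integrable_sq)
    (fun τ hτ t => ?_) hYs.tendsto_atTop_zero (fun τ _ => ?_)
  -- The state is recovered by subtracting the control window; the factor `a^D` only helps since `a²
  -- ≥ 1`.
  · have : predictor a b D x u i t ω + ∑ τ ∈ Finset.Icc 1 D,
        -b i * a i ^ (τ - 1) * u ((t : ℤ) - τ) ω i = a i ^ D * x t ω i := by
      simp only [predictor, mul_assoc, ← Finset.mul_sum]
      ring
    rw [this, mul_pow, ← pow_mul, mul_comm D 2, pow_mul]
    exact le_mul_of_one_le_left (sq_nonneg _) (one_le_pow₀ ha)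
  · have := Finset.mem_Icc.1 hτ
    exact (((hL.sqAdapted hN t).2 _ (by omega) (by omega) i).const_mul _).integrable_sq
  · simpa only [mul_pow, integral_const_mul, mul_zero] using
      (tendsto_shift_sub (f := fun s => ∫ ω, u s ω i ^ 2 ∂μ) τ hUs.tendsto_atTop_zero).const_mul
        ((-b i) ^ 2 * (a i ^ (τ - 1)) ^ 2)

end Sufficiency

lemma integral_dotProduct_self {f : Ω → Fin n → ℝ}
    (hf : ∀ i, Integrable (fun ω => f ω i ^ 2) μ) :
    Integrable (fun ω => f ω ⬝ᵥ f ω) μ ∧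
      ∫ ω, f ω ⬝ᵥ f ω ∂μ = ∑ i, ∫ ω, f ω i ^ 2 ∂μ := by
  simp only [dotProduct, ← sq]
  exact ⟨integrable_finsetSum _ fun i _ => hf i, integral_finsetSum _ fun i _ => hf i⟩

/-- The diagonal system is stabilizable iff every non-contracting coordinate obeys the bound. -/
lemma stabilizable_diagonal_iff (hN : IsNoisePair μ w v σ₀ σD)
    (hs : ∀ i, 1 ≤ a i ^ 2 → 0 < σ₀ ^ 2 * c i ^ 2 + σD ^ 2 * cbar i ^ 2) (D : ℕ) :
    Stabilizable μ w v (Matrix.diagonal a) (Matrix.diagonal c) (Matrix.diagonal b)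
      (Matrix.diagonal cbar) D ↔
    ∀ i, 1 ≤ a i ^ 2 →
      (a i ^ D) ^ 2 * (σ₀ ^ 2 * c i ^ 2 + σD ^ 2 * cbar i ^ 2) * (a i ^ 2 - 1) < b i ^ 2 := by
  refine ⟨fun hS i hi => hS.lt_of_one_le hN hi (hs i hi), fun h => ?_⟩
  let k : Fin n → ℝ := fun i => if 1 ≤ a i ^ 2 then a i * b i /
      (b i ^ 2 + (a i ^ D) ^ 2 * (σ₀ ^ 2 * c i ^ 2 + σD ^ 2 * cbar i ^ 2)) else 0
  refine ⟨predictorGain a b k D, fun x₀ φ => ?_⟩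
  obtain ⟨x, u, hL⟩ := exists_isClosedLoop w v (Matrix.diagonal a) (Matrix.diagonal c)
    (Matrix.diagonal b) (Matrix.diagonal cbar) D (predictorGain a b k D) x₀ φ
  have hstab : ∀ i, Summable (fun t : ℕ => ∫ ω, u t ω i ^ 2 ∂μ) ∧
      Tendsto (fun t : ℕ => ∫ ω, x t ω i ^ 2 ∂μ) atTop (𝓝 0) := fun i => by
    by_cases hi : 1 ≤ a i ^ 2
    · exact hL.stable_of_one_le hN hi (hs i hi) (if_pos hi) (h i hi)
    · exact hL.stable_of_sq_lt_one (not_le.1 hi) (if_neg hi)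
  have hx := fun t => integral_dotProduct_self (μ := μ) (f := x t) fun i =>
    ((hL.sqAdapted hN t).1 i).integrable_sq
  have hu := fun t : ℕ => integral_dotProduct_self (μ := μ) (f := u t) fun i =>
    ((hL.sqAdapted hN t).2 t (by omega) le_rfl i).integrable_sq
  refine ⟨x, u, hL, fun t => (hu t).1, ?_, fun t => (hx t).1, ?_⟩
  · simp only [(hu _).2]
    exact summable_sum fun i _ => (hstab i).1
  · simp only [(hx _).2]
    simpa using tendsto_finsetSum Finset.univ fun i _ => (hstab i).2

end Criterion

/-! ### The maximal delay. -/

lemma pow_mul_lt_iff_lt_div_log {a b s : ℝ} (ha : 1 < a ^ 2) (hb : b ≠ 0) (hs : 0 < s) (D : ℕ) :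
    (a ^ D) ^ 2 * s * (a ^ 2 - 1) < b ^ 2 ↔
      (D : ℝ) < (Real.log (b ^ 2) - Real.log s - Real.log (a ^ 2 - 1)) / Real.log (a ^ 2) := by
  have h1 : 0 < a ^ 2 - 1 := by linarith
  have h2 : 0 < a ^ 2 := by linarith
  have h3 : 0 < (a ^ 2) ^ D := by positivity
  rw [lt_div_iff₀ (Real.log_pos ha), ← pow_mul, mul_comm D 2, pow_mul,
    ← Real.log_lt_log_iff (by positivity) (by positivity), Real.log_mul (by positivity) h1.ne',
    Real.log_mul h3.ne' hs.ne', Real.log_pow]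
  constructor <;> intro h <;> linarith

theorem theorem4 {n : ℕ} (a c b cbar : Fin n → ℝ) (σ₀ σD : ℝ)
    (hb : ∀ i, b i ≠ 0)
    (hs : ∀ i, 1 ≤ a i ^ 2 → 0 < σ₀ ^ 2 * c i ^ 2 + σD ^ 2 * cbar i ^ 2) :
    ∃ Dmax : EReal,
      (∀ (Ω : Type*) [MeasurableSpace Ω] (μ : Measure Ω) [IsProbabilityMeasure μ]
          (w v : ℕ → Ω → ℝ), IsNoisePair μ w v σ₀ σD → ∀ D : ℕ,
          (Stabilizable μ w v (Matrix.diagonal a) (Matrix.diagonal c) (Matrix.diagonal b)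
              (Matrix.diagonal cbar) D ↔ ((D : ℝ) : EReal) < Dmax)) ∧
      ((∀ i, 1 ≤ a i ^ 2 → a i ^ 2 = 1) → Dmax = ⊤) ∧
      (((∀ i, 1 ≤ a i ^ 2 →
            a i ^ 2 < b i ^ 2 / (σ₀ ^ 2 * c i ^ 2 + σD ^ 2 * cbar i ^ 2) + 1) ∧
          (∃ j, 1 < a j ^ 2)) →
        IsLeast {y : EReal | ∃ i, 1 < a i ^ 2 ∧
          y = (((Real.log (b i ^ 2) - Real.log (σ₀ ^ 2 * c i ^ 2 + σD ^ 2 * cbar i ^ 2)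
            - Real.log (a i ^ 2 - 1)) / Real.log (a i ^ 2) : ℝ) : EReal)} Dmax) ∧
      ((∃ i, 1 ≤ a i ^ 2 ∧
          b i ^ 2 / (σ₀ ^ 2 * c i ^ 2 + σD ^ 2 * cbar i ^ 2) + 1 ≤ a i ^ 2) → Dmax = 0) := by
  by_cases hbad : ∃ i, 1 ≤ a i ^ 2 ∧
      b i ^ 2 / (σ₀ ^ 2 * c i ^ 2 + σD ^ 2 * cbar i ^ 2) + 1 ≤ a i ^ 2
  -- The case is split off because the minimum of the quotients may be negative here. Since `a^(2D)
  -- ≥ 1`, a bound failing at `D = 0` fails for every `D`.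
  · refine ⟨0, fun Ω _ μ _ w v hN D => ?_, fun h => ?_, fun h => ?_, fun _ => rfl⟩
    · obtain ⟨i, hi, hle⟩ := hbad
      refine iff_of_false (fun hS => ?_) (not_lt.2 (by exact_mod_cast Nat.cast_nonneg D))
      have hlt := hS.lt_of_one_le hN hi (hs i hi)
      have hsi := hs i hi
      have h1 : b i ^ 2 ≤ (a i ^ 2 - 1) * (σ₀ ^ 2 * c i ^ 2 + σD ^ 2 * cbar i ^ 2) :=
        (div_le_iff₀ hsi).1 (by linarith)
      have h2 : 1 ≤ (a i ^ D) ^ 2 := by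
        rw [← pow_mul, mul_comm D 2, pow_mul]
        exact one_le_pow₀ hi
      have h3 : 0 ≤ (a i ^ 2 - 1) * (σ₀ ^ 2 * c i ^ 2 + σD ^ 2 * cbar i ^ 2) :=
        (sq_nonneg _).trans h1
      have h4 := le_mul_of_one_le_left h3 h2
      linarith
    · obtain ⟨i, hi, hle⟩ := hbad
      have := div_pos (pow_pos (abs_pos.2 (hb i)) 2) (hs i hi)
      rw [sq_abs] at this
      linarith [h i hi]
    · obtain ⟨i, hi, hle⟩ := hbad
      exact absurd (h.1 i hi) (not_lt.2 hle)
  · classical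
    set g : Fin n → EReal := fun i =>
      (((Real.log (b i ^ 2) - Real.log (σ₀ ^ 2 * c i ^ 2 + σD ^ 2 * cbar i ^ 2)
        - Real.log (a i ^ 2 - 1)) / Real.log (a i ^ 2) : ℝ) : EReal) with hg
    set S : Finset (Fin n) := Finset.univ.filter fun i => 1 < a i ^ 2 with hS
    -- An empty infimum is `⊤`, which gives a); coordinates with `a² = 1` satisfy the bound for
    -- every `D`, as it reads `0 < b²`.
    refine ⟨S.inf g, fun Ω _ μ _ w v hN D => ?_, fun h => ?_, fun h => ⟨?_, ?_⟩,
      fun h => absurd h hbad⟩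
    · rw [stabilizable_diagonal_iff hN hs, Finset.lt_inf_iff (EReal.coe_lt_top _)]
      constructor
      · intro h i hi
        have hi : 1 < a i ^ 2 := (Finset.mem_filter.1 hi).2
        exact EReal.coe_lt_coe_iff.2
          ((pow_mul_lt_iff_lt_div_log hi (hb i) (hs i hi.le) D).1 (h i hi.le))
      · intro h i hi
        rcases hi.lt_or_eq with hlt | heq
        · exact (pow_mul_lt_iff_lt_div_log hlt (hb i) (hs i hi) D).2
            (EReal.coe_lt_coe_iff.1 (h i (Finset.mem_filter.2 ⟨Finset.mem_univ i, hlt⟩)))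
        · have := pow_pos (abs_pos.2 (hb i)) 2
          rw [sq_abs] at this
          rw [← heq, sub_self, mul_zero]
          exact this
    · have : S = ∅ := Finset.filter_eq_empty_iff.2 fun i _ hi => hi.ne' (h i hi.le)
      rw [this, Finset.inf_empty]
    · obtain ⟨j, hj⟩ := h.2
      obtain ⟨i, hi, he⟩ := S.exists_mem_eq_inf ⟨j, Finset.mem_filter.2 ⟨Finset.mem_univ j, hj⟩⟩ g
      exact ⟨i, (Finset.mem_filter.1 hi).2, he⟩
    · rintro y ⟨i, hi, rfl⟩
      exact Finset.inf_le (f := g) (Finset.mem_filter.2 ⟨Finset.mem_univ i, hi⟩)
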